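/- Let $K$ be a field and let $C$ be a coalgebra over $K$ with comultiplication $c\mapsto c_1\otimes c_2$ and counit $\varepsilon$. Let $C^*=\mathrm{Hom}_K(C,K)$ be the dual algebra, with product $(f*g)(c)=f(c_1)g(c_2)$ and unit $\varepsilon$. Every right $C$-comodule $M$ is a left $C^*$-module via $f\cdot m=m_0f(m_1)$, and every left $C$-comodule $M$ is a right $C^*$-module via $m\cdot f=f(m_{-1})m_0$; in particular $C$ is a left and a right $C^*$-module. The rational part $\mathrm{Rat}(M)$ of a right (left) $C^*$-module $M$ is the submodule of all $m\in M$ for which there are finitely many $c_i\in C$, $m_i\in M$ with $m\cdot f=\sum_i f(c_i)m_i$ (respectively $f\cdot m=\sum_i f(c_i)m_i$) for all $f\in C^*$; it is a left (right) $C$-comodule in a unique way compatible with its $C^*$-module structure. The coalgebra $C$ is called left (right) semiperfect if every finite dimensional left (right) $C$-comodule has a projective cover in the category of left (right) $C$-comodules, and semiperfect if it is both left and right semiperfect. **Theorem.** One has $C\cong \mathrm{Rat}(C^*_{C^*})$ as right $C^*$-modules if and only if $C\cong \mathrm{Rat}(C^*_{C^*})$ as left $C$-comodules. If this holds, then $C$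 is left semiperfect and also right semiperfect, hence semiperfect, and $C\cong \mathrm{Rat}({}_{C^*}C^*)$ as left $C^*$-modules. -/

import Mathlib

open scoped TensorProduct

universe u v w

namespace CoFrob

universe w₁

/-- The dual algebra `C*` of a coalgebra `C`: all linear forms on `C`, with the convolution product
`(f * g)(c) = f(c₁) g(c₂)` and with the counit as unit. Left `C*`-modules are `Module (DualAlg K C)`
and right `C*`-modules are `Module (DualAlg K C)ᵐᵒᵖ`. -/
abbrev DualAlg (K : Type u) (C : Type v) [Field K] [AddCommGroup C] [Module K C]
    [Coalgebra K C] : Type (max u v) :=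
  WithConv (C →ₗ[K] K)

section Contraction

variable {K : Type u} {C : Type v} [Field K] [AddCommGroup C] [Module K C]

/-- The contraction `m ⊗ c ↦ f(c) m`. -/
def evalRight (M : Type w) [AddCommGroup M] [Module K M] (f : C →ₗ[K] K) : M ⊗[K] C →ₗ[K] M :=
  (TensorProduct.rid K M).toLinearMap ∘ₗ f.lTensor M

/-- The contraction `c ⊗ m ↦ f(c) m`. -/
def evalLeft (M : Type w) [AddCommGroup M] [Module K M] (f : C →ₗ[K] K) : C ⊗[K] M →ₗ[K] M :=
  (TensorProduct.lid K M).toLinearMap ∘ₗ f.rTensor M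

variable {M : Type w} [AddCommGroup M] [Module K M]

@[simp] lemma evalRight_tmul (f : C →ₗ[K] K) (m : M) (c : C) :
    evalRight M f (m ⊗ₜ[K] c) = f c • m := by
  simp [evalRight]

@[simp] lemma evalLeft_tmul (f : C →ₗ[K] K) (c : C) (m : M) :
    evalLeft M f (c ⊗ₜ[K] m) = f c • m := by
  simp [evalLeft]

lemma evalRight_natural {N : Type w₁} [AddCommGroup N] [Module K N] (g : C →ₗ[K] K)
    (ρ : M →ₗ[K] N) (t : M ⊗[K] C) :
    evalRight N g (ρ.rTensor C t) = ρ (evalRight M g t) := by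
  induction t with
  | zero => simp
  | add x y hx hy => simp [hx, hy]
  | tmul m c => simp

lemma evalLeft_natural {N : Type w₁} [AddCommGroup N] [Module K N] (g : C →ₗ[K] K)
    (ρ : M →ₗ[K] N) (t : C ⊗[K] M) :
    evalLeft N g (ρ.lTensor C t) = ρ (evalLeft M g t) := by
  induction t with
  | zero => simp
  | add x y hx hy => simp [hx, hy]
  | tmul c m => simp

variable [Coalgebra K C]

lemma evalRight_mul (f g : DualAlg K C) (t : M ⊗[K] C) :
    evalRight M (f * g).ofConv t =
      evalRight M f.ofConv (evalRight (M ⊗[K] C) g.ofConv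
        ((TensorProduct.assoc K M C C).symm ((Coalgebra.comul (R := K) (A := C)).lTensor M t))) := by
  induction t with
  | zero => simp
  | add x y hx hy => simp only [map_add, hx, hy]
  | tmul m c =>
    rw [evalRight_tmul, LinearMap.lTensor_tmul, LinearMap.convMul_apply]
    generalize Coalgebra.comul (R := K) c = x
    induction x with
    | zero => simp
    | add x y hx hy => simp only [map_add, add_smul, TensorProduct.tmul_add, hx, hy]
    | tmul a b => simp [smul_smul, mul_comm]

lemma evalLeft_mul (f g : DualAlg K C) (t : C ⊗[K] M) :
    evalLeft M (f * g).ofConv t =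
      evalLeft M g.ofConv (evalLeft (C ⊗[K] M) f.ofConv
        (TensorProduct.assoc K C C M ((Coalgebra.comul (R := K) (A := C)).rTensor M t))) := by
  induction t with
  | zero => simp
  | add x y hx hy => simp only [map_add, hx, hy]
  | tmul c m =>
    rw [evalLeft_tmul, LinearMap.rTensor_tmul, LinearMap.convMul_apply]
    generalize Coalgebra.comul (R := K) c = x
    induction x with
    | zero => simp
    | add x y hx hy => simp only [map_add, add_smul, TensorProduct.add_tmul, hx, hy]
    | tmul a b => simp [smul_smul]

end Contraction

section Comodules

variable (K : Type u) (C : Type v) [Field K] [AddCommGroup C] [Module K C] [Coalgebra K C]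

/-- A right `C`-comodule structure on the vector space `M`. -/
structure RightComodule (M : Type w) [AddCommGroup M] [Module K M] where
  /-- the coaction `m ↦ m₀ ⊗ m₁` -/
  coact : M →ₗ[K] M ⊗[K] C
  coassoc : (TensorProduct.assoc K M C C).toLinearMap ∘ₗ coact.rTensor C ∘ₗ coact =
    (Coalgebra.comul (R := K) (A := C)).lTensor M ∘ₗ coact
  counit_coact : (Coalgebra.counit (R := K) (A := C)).lTensor M ∘ₗ coact =
    (TensorProduct.mk K M K).flip 1

/-- A left `C`-comodule structure on the vector space `M`. -/
structure LeftComodule (M : Type w) [AddCommGroup M] [Module K M] where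
  /-- the coaction `m ↦ m₋₁ ⊗ m₀` -/
  coact : M →ₗ[K] C ⊗[K] M
  coassoc : (TensorProduct.assoc K C C M).toLinearMap ∘ₗ
      (Coalgebra.comul (R := K) (A := C)).rTensor M ∘ₗ coact =
    coact.lTensor C ∘ₗ coact
  counit_coact : (Coalgebra.counit (R := K) (A := C)).rTensor M ∘ₗ coact =
    TensorProduct.mk K K M 1

/-- The right comodule `C`. -/
def RightComodule.regular : RightComodule K C C where
  coact := Coalgebra.comul
  coassoc := Coalgebra.coassoc
  counit_coact := Coalgebra.lTensor_counit_comp_comul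

/-- The left comodule `C`. -/
def LeftComodule.regular : LeftComodule K C C where
  coact := Coalgebra.comul
  coassoc := Coalgebra.coassoc
  counit_coact := Coalgebra.rTensor_counit_comp_comul

variable {K C}
variable {M : Type w} [AddCommGroup M] [Module K M] {N : Type w₁} [AddCommGroup N] [Module K N]

/-- Morphisms of right comodules. -/
def RightComodule.IsHom (ρ : RightComodule K C M) (σ : RightComodule K C N) (φ : M →ₗ[K] N) :
    Prop :=
  σ.coact ∘ₗ φ = φ.rTensor C ∘ₗ ρ.coact

/-- Morphisms of left comodules. -/
def LeftComodule.IsHom (ρ : LeftComodule K C M) (σ : LeftComodule K C N) (φ : M →ₗ[K] N) :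
    Prop :=
  σ.coact ∘ₗ φ = φ.lTensor C ∘ₗ ρ.coact

/-- `N ⊆ M` is a right subcomodule: the coaction maps `N` into (the image in `M ⊗ C` of)
`N ⊗ C`. -/
def RightComodule.IsSubcomodule (ρ : RightComodule K C M) (N : Submodule K M) : Prop :=
  ∀ m ∈ N, ρ.coact m ∈ LinearMap.range (N.subtype.rTensor C)

/-- `N ⊆ M` is a left subcomodule: the coaction maps `N` into (the image in `C ⊗ M` of)
`C ⊗ N`. -/
def LeftComodule.IsSubcomodule (ρ : LeftComodule K C M) (N : Submodule K M) : Prop :=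
  ∀ m ∈ N, ρ.coact m ∈ LinearMap.range (N.subtype.lTensor C)

/-- The right comodule `M` is projective in the category of right comodules (over a field, the
epimorphisms of comodules are the surjective ones). -/
def RightComodule.IsProjective (ρ : RightComodule K C M) : Prop :=
  ∀ (A B : Type w) [AddCommGroup A] [Module K A] [AddCommGroup B] [Module K B]
    (α : RightComodule K C A) (β : RightComodule K C B) (p : A →ₗ[K] B) (φ : M →ₗ[K] B),
    α.IsHom β p → Function.Surjective p → ρ.IsHom β φ →
      ∃ ψ : M →ₗ[K] A, ρ.IsHom α ψ ∧ p ∘ₗ ψ = φ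

/-- The left comodule `M` is projective in the category of left comodules. -/
def LeftComodule.IsProjective (ρ : LeftComodule K C M) : Prop :=
  ∀ (A B : Type w) [AddCommGroup A] [Module K A] [AddCommGroup B] [Module K B]
    (α : LeftComodule K C A) (β : LeftComodule K C B) (p : A →ₗ[K] B) (φ : M →ₗ[K] B),
    α.IsHom β p → Function.Surjective p → ρ.IsHom β φ →
      ∃ ψ : M →ₗ[K] A, ρ.IsHom α ψ ∧ p ∘ₗ ψ = φ

/-- The right comodule `M` has a projective cover: a surjective morphism `π : P → M` with `P`
projective whose kernel is superfluous, that is, `P` is the only subcomodule `N` of `P` with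
`N + ker π = P`. -/
def RightComodule.HasProjectiveCover (ρ : RightComodule K C M) : Prop :=
  ∃ (P : Type w) (_ : AddCommGroup P) (_ : Module K P) (σ : RightComodule K C P) (π : P →ₗ[K] M),
    σ.IsProjective ∧ σ.IsHom ρ π ∧ Function.Surjective π ∧
      ∀ N : Submodule K P, σ.IsSubcomodule N → N ⊔ LinearMap.ker π = ⊤ → N = ⊤

/-- The left comodule `M` has a projective cover. -/
def LeftComodule.HasProjectiveCover (ρ : LeftComodule K C M) : Prop :=
  ∃ (P : Type w) (_ : AddCommGroup P) (_ : Module K P) (σ : LeftComodule K C P) (π : P →ₗ[K] M),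
    σ.IsProjective ∧ σ.IsHom ρ π ∧ Function.Surjective π ∧
      ∀ N : Submodule K P, σ.IsSubcomodule N → N ⊔ LinearMap.ker π = ⊤ → N = ⊤

variable (K C)

/-- `C` is right semiperfect: every finite dimensional right comodule (with underlying space in
`Type w`) has a projective cover. -/
def IsRightSemiperfect : Prop :=
  ∀ (M : Type w) [AddCommGroup M] [Module K M] [FiniteDimensional K M]
    (ρ : RightComodule K C M), ρ.HasProjectiveCover

/-- `C` is left semiperfect: every finite dimensional left comodule (with underlying space in
`Type w`) has a projective cover. -/
def IsLeftSemiperfect : Prop :=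
  ∀ (M : Type w) [AddCommGroup M] [Module K M] [FiniteDimensional K M]
    (ρ : LeftComodule K C M), ρ.HasProjectiveCover

end Comodules

section Modules

variable {K : Type u} {C : Type v} [Field K] [AddCommGroup C] [Module K C] [Coalgebra K C]

/-- The left `C*`-module underlying a right comodule: `f · m = m₀ f(m₁)`. -/
abbrev RightComodule.toModule {M : Type w} [AddCommGroup M] [Module K M]
    (ρ : RightComodule K C M) : Module (DualAlg K C) M where
  smul f m := evalRight M f.ofConv (ρ.coact m)
  one_smul m := by
    change TensorProduct.rid K M ((LinearMap.lTensor M _) (ρ.coact m)) = m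
    have h := LinearMap.congr_fun ρ.counit_coact m
    have h2 : (1 : DualAlg K C).ofConv = Coalgebra.counit := by ext; simp
    rw [h2]
    simp only [LinearMap.comp_apply] at h
    rw [h]; simp
  mul_smul f g m := by
    change evalRight M _ (ρ.coact m) =
      evalRight M _ (ρ.coact (evalRight M _ (ρ.coact m)))
    have h := LinearMap.congr_fun ρ.coassoc m
    simp only [LinearMap.comp_apply, LinearEquiv.coe_coe] at h
    rw [evalRight_mul, ← h, LinearEquiv.symm_apply_apply, evalRight_natural]
  smul_zero f := by
    change evalRight M _ (ρ.coact 0) = 0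
    simp
  smul_add f m n := by
    change evalRight M _ (ρ.coact (m + n)) =
      evalRight M _ (ρ.coact m) + evalRight M _ (ρ.coact n)
    simp
  add_smul f g m := by
    change evalRight M (f.ofConv + g.ofConv) (ρ.coact m) =
      evalRight M _ (ρ.coact m) + evalRight M _ (ρ.coact m)
    simp [evalRight, LinearMap.lTensor_add]
  zero_smul m := by
    change evalRight M 0 (ρ.coact m) = 0
    simp [evalRight]

/-- The right `C*`-module underlying a left comodule: `m · f = f(m₋₁) m₀`. -/
abbrev LeftComodule.toModule {M : Type w} [AddCommGroup M] [Module K M]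
    (ρ : LeftComodule K C M) : Module (DualAlg K C)ᵐᵒᵖ M where
  smul f m := evalLeft M f.unop.ofConv (ρ.coact m)
  one_smul m := by
    change TensorProduct.lid K M ((LinearMap.rTensor M _) (ρ.coact m)) = m
    have h := LinearMap.congr_fun ρ.counit_coact m
    have h2 : (1 : DualAlg K C).ofConv = Coalgebra.counit := by ext; simp
    rw [MulOpposite.unop_one, h2]
    simp only [LinearMap.comp_apply] at h
    rw [h]; simp
  mul_smul f g m := by
    change evalLeft M (g.unop * f.unop).ofConv (ρ.coact m) =
      evalLeft M _ (ρ.coact (evalLeft M _ (ρ.coact m)))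
    have h := LinearMap.congr_fun ρ.coassoc m
    simp only [LinearMap.comp_apply, LinearEquiv.coe_coe] at h
    rw [evalLeft_mul, h, evalLeft_natural]
  smul_zero f := by
    change evalLeft M _ (ρ.coact 0) = 0
    simp
  smul_add f m n := by
    change evalLeft M _ (ρ.coact (m + n)) =
      evalLeft M _ (ρ.coact m) + evalLeft M _ (ρ.coact n)
    simp
  add_smul f g m := by
    change evalLeft M (f.unop.ofConv + g.unop.ofConv) (ρ.coact m) =
      evalLeft M _ (ρ.coact m) + evalLeft M _ (ρ.coact m)
    simp [evalLeft, LinearMap.rTensor_add]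
  zero_smul m := by
    change evalLeft M 0 (ρ.coact m) = 0
    simp [evalLeft]

/-- `C` as a left `C*`-module: `f · c = c₁ f(c₂)`. -/
instance : Module (DualAlg K C) C := (RightComodule.regular K C).toModule

/-- `C` as a right `C*`-module: `c · f = f(c₁) c₂`. -/
instance : Module (DualAlg K C)ᵐᵒᵖ C := (LeftComodule.regular K C).toModule

variable (K C)

/-- The rational part of a left `C*`-module `M`: the elements `m` for which there is a tensor
`∑ mᵢ ⊗ cᵢ` in `M ⊗ C` with `f · m = ∑ f(cᵢ) mᵢ` for all `f` in `C*`. -/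
def leftRat (M : Type w) [AddCommGroup M] [Module K M] [Module (DualAlg K C) M] :
    Submodule (DualAlg K C) M where
  carrier := {m | ∃ t : M ⊗[K] C, ∀ f : DualAlg K C, f • m = evalRight M f.ofConv t}
  zero_mem' := ⟨0, fun f => by simp⟩
  add_mem' := by
    rintro a b ⟨s, hs⟩ ⟨t, ht⟩
    exact ⟨s + t, fun f => by rw [smul_add, hs, ht, map_add]⟩
  smul_mem' := by
    rintro g m ⟨t, ht⟩
    exact ⟨_, fun f => by rw [← mul_smul, ht, evalRight_mul]⟩

/-- The rational part of a right `C*`-module `M`: the elements `m` for which there is a tensor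
`∑ cᵢ ⊗ mᵢ` in `C ⊗ M` with `m · f = ∑ f(cᵢ) mᵢ` for all `f` in `C*`. -/
def rightRat (M : Type w) [AddCommGroup M] [Module K M] [Module (DualAlg K C)ᵐᵒᵖ M] :
    Submodule (DualAlg K C)ᵐᵒᵖ M where
  carrier := {m | ∃ t : C ⊗[K] M, ∀ f : DualAlg K C,
    MulOpposite.op f • m = evalLeft M f.ofConv t}
  zero_mem' := ⟨0, fun f => by simp⟩
  add_mem' := by
    rintro a b ⟨s, hs⟩ ⟨t, ht⟩
    exact ⟨s + t, fun f => by rw [smul_add, hs, ht, map_add]⟩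
  smul_mem' := by
    rintro g m ⟨t, ht⟩
    exact ⟨_, fun f => by
      rw [← mul_smul, ← MulOpposite.op_unop g, ← MulOpposite.op_mul, ht, evalLeft_mul]⟩

/-- `C ≅ Rat(C*_{C*})` as right `C*`-modules. -/
def IsoRightRat : Prop :=
  Nonempty (C ≃ₗ[(DualAlg K C)ᵐᵒᵖ] rightRat K C (DualAlg K C))

/-- `C ≅ Rat(_{C*}C*)` as left `C*`-modules. -/
def IsoLeftRat : Prop :=
  Nonempty (C ≃ₗ[DualAlg K C] leftRat K C (DualAlg K C))

/-- `C ≅ Rat(C*_{C*})` as left `C`-comodules. The left comodule structure of a rational right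
`C*`-module is the one whose underlying right `C*`-module is the given one; over a field there is
only one such structure, because the map `C ⊗ M → Hom(C*, M)`, `c ⊗ m ↦ (f ↦ f(c) m)`, is
injective. -/
def IsoRightRatComodule : Prop :=
  ∃ ρ : LeftComodule K C (rightRat K C (DualAlg K C)),
    (∀ (f : DualAlg K C) (m : rightRat K C (DualAlg K C)),
      MulOpposite.op f • m = evalLeft _ f.ofConv (ρ.coact m)) ∧
    ∃ e : C ≃ₗ[K] rightRat K C (DualAlg K C),
      (LeftComodule.regular K C).IsHom ρ e.toLinearMap

end Modules

end CoFrob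

/-!
Write `A = C*`, let `φ : C → A` be an isomorphism of right `A`-modules onto the rational part `I` of
the right module `A`, and let `β(c, d) = φ(c)(d)`. The linearity of `φ` says that
`c₁ β(c₂, d) = β(c, d₁) d₂`, so the transpose `ψ(d) = β(-, d)` is a morphism of left modules; its
values are rational on the left. Since `φ` is injective, `ψ(C)` separates the points of `C`, hence
contains forms with prescribed values on a given finite dimensional subspace of `C`. So the rational
part of the left module `A` is dense.

The main point is that the situation is symmetric (`leftRat_subset_rightRat`): every `e` that is
rational on the left is rational on the right. First, `C · I = C`: if `ψ(y)` agrees with the counit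
on a large enough subspace, then `d = ψ(y) · d = y · φ(d)`. Consequently `I x = 0` forces `x = 0`.
Now `I e` is finite dimensional because `e` is rational on the left, and contained in the right
ideal `I`; so it is annihilated by all forms `f` that vanish on some finite dimensional subspace,
and `I e f = 0` gives `e f = 0` for these `f`. It follows that `I` is dense as well, which means
that `ψ` is injective. If `f` is rational on the left, then it is rational on the right,
and therefore `f = f * ψ(y) = ψ(f · y)` for a suitable `y`. So `ψ` is an isomorphism of `C` onto the
rational part of the left module `A`.

Semiperfectness follows from the density of the two rational parts
(`isRightSemiperfect_of_separatesPoints`, `isLeftSemiperfect_of_separatesPoints`). Let `M` be a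
finite dimensional right comodule. There is a rational `e` that acts on `M` as the identity, and a
polynomial in `e` is an idempotent `p` with the same properties. Then `A p ⊗ M` is a finite
dimensional projective comodule that maps onto `M`, and a projective of minimal dimension among
those that map onto `M` is a projective cover. The statement for left comodules is this one for the
co-opposite coalgebra.
-/

namespace CoFrob

universe w₁

/-! ### Contractions and tensors -/

section Contractions

variable {K : Type u} {C : Type v} [Field K] [AddCommGroup C] [Module K C]
variable {M : Type w} [AddCommGroup M] [Module K M]

lemma evalRight_add (f g : C →ₗ[K] K) (t : M ⊗[K] C) :
    evalRight M (f + g) t = evalRight M f t + evalRight M g t := by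
  simp [evalRight, LinearMap.lTensor_add]

lemma evalRight_sub (f g : C →ₗ[K] K) (t : M ⊗[K] C) :
    evalRight M (f - g) t = evalRight M f t - evalRight M g t := by
  simp [evalRight, LinearMap.lTensor_sub]

lemma evalRight_smul (a : K) (f : C →ₗ[K] K) (t : M ⊗[K] C) :
    evalRight M (a • f) t = a • evalRight M f t := by
  simp [evalRight, LinearMap.lTensor_smul]

lemma evalRight_comm (f : C →ₗ[K] K) (t : C ⊗[K] M) :
    evalRight M f (TensorProduct.comm K C M t) = evalLeft M f t := by
  induction t with
  | zero => simp
  | add x y hx hy => simp only [map_add, hx, hy]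
  | tmul c m => simp

lemma evalLeft_comm (f : C →ₗ[K] K) (t : M ⊗[K] C) :
    evalLeft M f (TensorProduct.comm K M C t) = evalRight M f t := by
  induction t with
  | zero => simp
  | add x y hx hy => simp only [map_add, hx, hy]
  | tmul c m => simp

/-- A tensor in `M ⊗ C` is determined by its contractions: the map `M ⊗ C → Hom(C*, M)` is
injective. -/
lemma evalRight_ext {s t : M ⊗[K] C} (h : ∀ f : C →ₗ[K] K, evalRight M f s = evalRight M f t) :
    s = t := by
  classical
  let b := Module.Basis.ofVectorSpace K C
  apply (TensorProduct.equivFinsuppOfBasisRight (M := M) b).injective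
  ext i
  rw [TensorProduct.equivFinsuppOfBasisRight_apply, TensorProduct.equivFinsuppOfBasisRight_apply]
  exact h (b.coord i)

lemma evalLeft_ext {s t : C ⊗[K] M} (h : ∀ f : C →ₗ[K] K, evalLeft M f s = evalLeft M f t) :
    s = t := by
  apply (TensorProduct.comm K C M).injective
  exact evalRight_ext fun f => by rw [evalRight_comm, evalRight_comm, h]

/-- The contraction of `t` with `f` depends only on the restriction of `f` to a finite dimensional
subspace of `C`. -/
lemma exists_fg_evalRight_eq_zero (t : M ⊗[K] C) :
    ∃ D : Submodule K C, D.FG ∧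
      ∀ f : C →ₗ[K] K, (∀ d ∈ D, f d = 0) → evalRight M f t = 0 := by
  induction t with
  | zero => exact ⟨⊥, Submodule.fg_bot, fun f _ => by simp⟩
  | add x y hx hy =>
    obtain ⟨D, hD, hx⟩ := hx
    obtain ⟨E, hE, hy⟩ := hy
    refine ⟨D ⊔ E, hD.sup hE, fun f hf => ?_⟩
    rw [map_add, hx f fun d hd => hf d (Submodule.mem_sup_left hd),
      hy f fun d hd => hf d (Submodule.mem_sup_right hd), add_zero]
  | tmul m c =>
    refine ⟨Submodule.span K {c}, Submodule.fg_span_singleton c, fun f hf => ?_⟩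
    rw [evalRight_tmul, hf c (Submodule.mem_span_singleton_self c), zero_smul]

lemma exists_fg_evalRight_eq (t : M ⊗[K] C) :
    ∃ D : Submodule K C, D.FG ∧
      ∀ f g : C →ₗ[K] K, (∀ d ∈ D, f d = g d) → evalRight M f t = evalRight M g t := by
  obtain ⟨D, hD, h⟩ := exists_fg_evalRight_eq_zero t
  refine ⟨D, hD, fun f g hfg => ?_⟩
  rw [← sub_eq_zero, ← evalRight_sub]
  exact h _ fun d hd => by simp [hfg d hd]

lemma exists_fg_evalLeft_eq (t : C ⊗[K] M) :
    ∃ D : Submodule K C, D.FG ∧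
      ∀ f g : C →ₗ[K] K, (∀ d ∈ D, f d = g d) → evalLeft M f t = evalLeft M g t := by
  obtain ⟨D, hD, h⟩ := exists_fg_evalRight_eq (TensorProduct.comm K C M t)
  refine ⟨D, hD, fun f g hfg => ?_⟩
  rw [← evalRight_comm, ← evalRight_comm, h f g hfg]

/-- All contractions of `t` lie in a finite dimensional subspace of `M`. -/
lemma exists_fg_evalRight_mem (t : M ⊗[K] C) :
    ∃ V : Submodule K M, V.FG ∧ ∀ f : C →ₗ[K] K, evalRight M f t ∈ V := by
  induction t with
  | zero => exact ⟨⊥, Submodule.fg_bot, fun f => by simp⟩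
  | add x y hx hy =>
    obtain ⟨D, hD, hx⟩ := hx
    obtain ⟨E, hE, hy⟩ := hy
    refine ⟨D ⊔ E, hD.sup hE, fun f => ?_⟩
    rw [map_add]
    exact Submodule.add_mem_sup (hx f) (hy f)
  | tmul m c =>
    refine ⟨Submodule.span K {m}, Submodule.fg_span_singleton m, fun f => ?_⟩
    rw [evalRight_tmul]
    exact Submodule.smul_mem _ _ (Submodule.mem_span_singleton_self m)

/-- A linear map `C* → M` that factors through the restriction to a finite dimensional subspace of
`C` is the contraction of a tensor. -/
lemma exists_evalRight_eq (T : (C →ₗ[K] K) →ₗ[K] M) {D : Submodule K C} (hD : D.FG)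
    (hT : ∀ f : C →ₗ[K] K, (∀ d ∈ D, f d = 0) → T f = 0) :
    ∃ t : M ⊗[K] C, ∀ f, T f = evalRight M f t := by
  have : FiniteDimensional K D := Module.Finite.iff_fg.mpr hD
  let b := Module.finBasis K D
  -- the coordinate forms of `D`, extended to `C` through a projection onto `D`
  obtain ⟨π, hπ⟩ := D.subtype.exists_leftInverse_of_injective (by simp)
  have hπ' : ∀ d : D, π d = d := fun d => LinearMap.congr_fun hπ d
  refine ⟨∑ i, T (b.coord i ∘ₗ π) ⊗ₜ (b i : C), fun f => ?_⟩
  rw [map_sum, ← sub_eq_zero]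
  simp only [evalRight_tmul, ← map_smul, ← map_sum, ← map_sub]
  refine hT _ fun d hd => ?_
  have h := congrArg (fun x : D => f x) (b.sum_repr ⟨d, hd⟩)
  simp only [Submodule.coe_sum, map_sum, Submodule.coe_smul, map_smul] at h
  simp only [LinearMap.sub_apply, LinearMap.sum_apply, LinearMap.smul_apply,
    LinearMap.comp_apply, hπ' ⟨d, hd⟩, Module.Basis.coord_apply, ← h, smul_eq_mul]
  simp [mul_comm]

lemma exists_evalLeft_eq (T : (C →ₗ[K] K) →ₗ[K] M) {D : Submodule K C} (hD : D.FG)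
    (hT : ∀ f : C →ₗ[K] K, (∀ d ∈ D, f d = 0) → T f = 0) :
    ∃ t : C ⊗[K] M, ∀ f, T f = evalLeft M f t := by
  obtain ⟨t, ht⟩ := exists_evalRight_eq T hD hT
  exact ⟨TensorProduct.comm K M C t, fun f => by rw [ht, evalLeft_comm]⟩

/-- A set of linear forms on `C` separates points if its elements have no common zero but `0`. -/
def SeparatesPoints (S : Set (C →ₗ[K] K)) : Prop :=
  ∀ c : C, c ≠ 0 → ∃ f ∈ S, f c ≠ 0

/-- A space of linear forms that separates points is dense in the finite topology: it contains
forms with prescribed values on a given finite dimensional subspace. -/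
lemma SeparatesPoints.exists_eq_on {S : Submodule K (C →ₗ[K] K)}
    (hS : SeparatesPoints (S : Set (C →ₗ[K] K))) {D : Submodule K C} (hD : D.FG)
    (f : C →ₗ[K] K) : ∃ g ∈ S, ∀ d ∈ D, g d = f d := by
  have : FiniteDimensional K D := Module.Finite.iff_fg.mpr hD
  let r : (C →ₗ[K] K) →ₗ[K] Module.Dual K D := LinearMap.lcomp K K D.subtype
  have h0 : (S.map r).dualCoannihilator = ⊥ := by
    rw [eq_bot_iff]
    intro d hd
    by_contra hne
    obtain ⟨g, hg, hgd⟩ := hS d fun h => hne (by simpa using h)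
    exact hgd ((Submodule.mem_dualCoannihilator _).mp hd (r g) (Submodule.mem_map_of_mem hg))
  have h1 : S.map r = ⊤ := by
    rw [← Subspace.dualCoannihilator_dualAnnihilator_eq (W := S.map r), h0]
    simp
  obtain ⟨g, hg, hgf⟩ : r f ∈ S.map r := h1 ▸ Submodule.mem_top
  exact ⟨g, hg, fun d hd => LinearMap.congr_fun hgf ⟨d, hd⟩⟩

end Contractions

/-! ### The bilinear form of an isomorphism onto the rational part -/

section Dual

variable {K : Type u} {C : Type v} [Field K] [AddCommGroup C] [Module K C] [Coalgebra K C]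

lemma dual_smul_def (f : DualAlg K C) (c : C) :
    f • c = evalRight C f.ofConv (Coalgebra.comul (R := K) c) := rfl

lemma dual_op_smul_def (f : DualAlg K C) (c : C) :
    MulOpposite.op f • c = evalLeft C f.ofConv (Coalgebra.comul (R := K) c) := rfl

lemma mul_apply_eq_apply_smul (f g : DualAlg K C) (c : C) :
    (f * g).ofConv c = f.ofConv (g • c) := by
  rw [LinearMap.convMul_apply, dual_smul_def]
  generalize Coalgebra.comul (R := K) c = x
  induction x with
  | zero => simp
  | add x y hx hy => simp only [map_add, hx, hy]
  | tmul a b => simp [mul_comm]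

lemma mul_apply_eq_apply_op_smul (f g : DualAlg K C) (c : C) :
    (f * g).ofConv c = g.ofConv (MulOpposite.op f • c) := by
  rw [LinearMap.convMul_apply, dual_op_smul_def]
  generalize Coalgebra.comul (R := K) c = x
  induction x with
  | zero => simp
  | add x y hx hy => simp only [map_add, hx, hy]
  | tmul a b => simp

lemma eq_of_forall_apply_eq {c d : C} (h : ∀ f : DualAlg K C, f.ofConv c = f.ofConv d) :
    c = d := by
  rw [← sub_eq_zero, ← Module.forall_dual_apply_eq_zero_iff K]
  intro f
  rw [map_sub, sub_eq_zero]
  exact h (WithConv.toConv f)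

end Dual

section Form

variable {K : Type u} {C : Type v} [Field K] [AddCommGroup C] [Module K C] [Coalgebra K C]

/-- The linear forms underlying the rational part of the right module `C*`. -/
noncomputable def rightRatForms (K : Type u) (C : Type v) [Field K] [AddCommGroup C] [Module K C]
    [Coalgebra K C] : Submodule K (C →ₗ[K] K) :=
  ((rightRat K C (DualAlg K C)).restrictScalars K).map
    (WithConv.linearEquiv K (C →ₗ[K] K)).toLinearMap

/-- The linear forms underlying the rational part of the left module `C*`. -/
noncomputable def leftRatForms (K : Type u) (C : Type v) [Field K] [AddCommGroup C] [Module K C]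
    [Coalgebra K C] : Submodule K (C →ₗ[K] K) :=
  ((leftRat K C (DualAlg K C)).restrictScalars K).map
    (WithConv.linearEquiv K (C →ₗ[K] K)).toLinearMap

lemma mem_leftRatForms {f : C →ₗ[K] K} :
    f ∈ leftRatForms K C ↔ WithConv.toConv f ∈ leftRat K C (DualAlg K C) :=
  ⟨by rintro ⟨g, hg, rfl⟩; exact hg, fun h => ⟨_, h, rfl⟩⟩

lemma mem_rightRatForms {f : C →ₗ[K] K} :
    f ∈ rightRatForms K C ↔ WithConv.toConv f ∈ rightRat K C (DualAlg K C) :=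
  ⟨by rintro ⟨g, hg, rfl⟩; exact hg, fun h => ⟨_, h, rfl⟩⟩

lemma mem_leftRat_iff {x : DualAlg K C} : x ∈ leftRat K C (DualAlg K C) ↔
    ∃ t : DualAlg K C ⊗[K] C, ∀ f : DualAlg K C, f * x = evalRight _ f.ofConv t := Iff.rfl

lemma mem_rightRat_iff {x : DualAlg K C} : x ∈ rightRat K C (DualAlg K C) ↔
    ∃ t : C ⊗[K] DualAlg K C, ∀ f : DualAlg K C, x * f = evalLeft _ f.ofConv t := Iff.rfl

lemma ofConv_one : (1 : DualAlg K C).ofConv = Coalgebra.counit := by ext; simp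

/-- An element of `C*` that agrees with the counit on a suitable finite dimensional subspace of `C`
acts on a given element of `C` as the identity. -/
lemma exists_fg_smul_eq_self (c : C) :
    ∃ D : Submodule K C, D.FG ∧ ∀ f : DualAlg K C,
      (∀ d ∈ D, f.ofConv d = Coalgebra.counit (R := K) d) → f • c = c := by
  obtain ⟨D, hD, h⟩ := exists_fg_evalRight_eq (Coalgebra.comul (R := K) c)
  refine ⟨D, hD, fun f hf => ?_⟩
  nth_rw 2 [← one_smul (DualAlg K C) c]
  rw [dual_smul_def, dual_smul_def]
  exact h _ _ fun d hd => by rw [hf d hd, ofConv_one]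

lemma mem_rightRat_of_fg {x : DualAlg K C} {D : Submodule K C} (hD : D.FG)
    (h : ∀ f : DualAlg K C, (∀ d ∈ D, f.ofConv d = 0) → x * f = 0) :
    x ∈ rightRat K C (DualAlg K C) := by
  obtain ⟨t, ht⟩ := exists_evalLeft_eq
    (LinearMap.mulLeft K x ∘ₗ (WithConv.linearEquiv K (C →ₗ[K] K)).symm.toLinearMap) hD
    fun f hf => h (WithConv.toConv f) hf
  exact mem_rightRat_iff.mpr ⟨t, fun f => ht f.ofConv⟩

/-- A finite dimensional subspace of the rational part of the right module `C*` is annihilated by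
all forms that vanish on a suitable finite dimensional subspace of `C`. -/
lemma exists_fg_mul_eq_zero {F : Submodule K (DualAlg K C)} (hF : F.FG)
    (hR : ∀ x ∈ F, x ∈ rightRat K C (DualAlg K C)) :
    ∃ D : Submodule K C, D.FG ∧
      ∀ f : DualAlg K C, (∀ d ∈ D, f.ofConv d = 0) → ∀ x ∈ F, x * f = 0 := by
  classical
  obtain ⟨s, rfl⟩ := hF
  have hs : ∀ x : s, ∃ D : Submodule K C, D.FG ∧
      ∀ f : DualAlg K C, (∀ d ∈ D, f.ofConv d = 0) → (x : DualAlg K C) * f = 0 := by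
    intro x
    obtain ⟨t, ht⟩ := mem_rightRat_iff.mp (hR x (Submodule.subset_span x.2))
    obtain ⟨D, hD, h⟩ := exists_fg_evalLeft_eq t
    exact ⟨D, hD, fun f hf => by rw [ht, h f.ofConv 0 hf]; simp [evalLeft]⟩
  choose D hD h using hs
  refine ⟨⨆ x, D x, Submodule.fg_iSup _ hD, fun f hf x hx => ?_⟩
  induction hx using Submodule.span_induction with
  | mem x hx => exact h ⟨x, hx⟩ f fun d hd => hf d (Submodule.mem_iSup_of_mem _ hd)
  | zero => simp
  | add x y _ _ hx hy => rw [add_mul, hx, hy, add_zero]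
  | smul a x _ hx => rw [smul_mul_assoc, hx, smul_zero]

/-- The transpose `d ↦ (c ↦ φ(c)(d))` of a linear map `φ : C → C*`. -/
def transpose (φ : C →ₗ[K] DualAlg K C) : C →ₗ[K] DualAlg K C :=
  (WithConv.linearEquiv K (C →ₗ[K] K)).symm.toLinearMap ∘ₗ
    ((WithConv.linearEquiv K (C →ₗ[K] K)).toLinearMap ∘ₗ φ).flip

@[simp] lemma transpose_apply (φ : C →ₗ[K] DualAlg K C) (c d : C) :
    (transpose φ d).ofConv c = (φ c).ofConv d := rfl

variable {φ : C →ₗ[K] DualAlg K C}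

/-- The transpose of a morphism of right `C*`-modules is a morphism of left `C*`-modules. -/
lemma transpose_smul (hφ : ∀ f c, φ (MulOpposite.op f • c) = φ c * f) (f : DualAlg K C) (d : C) :
    transpose φ (f • d) = f * transpose φ d := by
  apply WithConv.ofConv_injective
  ext c
  rw [mul_apply_eq_apply_op_smul, transpose_apply, transpose_apply, hφ, mul_apply_eq_apply_smul]

lemma transpose_mem_leftRat (hφ : ∀ f c, φ (MulOpposite.op f • c) = φ c * f) (d : C) :
    transpose φ d ∈ leftRat K C (DualAlg K C) :=
  mem_leftRat_iff.mpr ⟨(transpose φ).rTensor C (Coalgebra.comul (R := K) d), fun f => by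
    rw [← transpose_smul hφ, evalRight_natural, dual_smul_def]⟩

/-- The forms `φ(-)(d)`. -/
abbrev transposeForms (φ : C →ₗ[K] DualAlg K C) : Submodule K (C →ₗ[K] K) :=
  LinearMap.range ((WithConv.linearEquiv K (C →ₗ[K] K)).toLinearMap ∘ₗ transpose φ)

lemma transposeForms_separatesPoints (hinj : Function.Injective φ) :
    SeparatesPoints (transposeForms φ : Set (C →ₗ[K] K)) := by
  intro c hc
  by_contra! h
  refine hc (hinj ?_)
  rw [map_zero]
  apply WithConv.ofConv_injective
  ext d
  exact h _ ⟨d, rfl⟩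

lemma exists_transpose_eq_counit (hinj : Function.Injective φ) {D : Submodule K C} (hD : D.FG) :
    ∃ y : C, ∀ d ∈ D, (transpose φ y).ofConv d = Coalgebra.counit (R := K) d := by
  obtain ⟨_, ⟨y, rfl⟩, hy⟩ :=
    (transposeForms_separatesPoints hinj).exists_eq_on hD (Coalgebra.counit (R := K))
  exact ⟨y, hy⟩

lemma leftRatForms_separatesPoints (hφ : ∀ f c, φ (MulOpposite.op f • c) = φ c * f)
    (hinj : Function.Injective φ) : SeparatesPoints (leftRatForms K C : Set (C →ₗ[K] K)) := by
  intro c hc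
  obtain ⟨_, ⟨d, rfl⟩, hd⟩ := transposeForms_separatesPoints hinj c hc
  exact ⟨_, mem_leftRatForms.mpr (transpose_mem_leftRat hφ d), hd⟩

/-- In terms of the form `β(c, d) = φ(c)(d)` this is the identity `d₁ β(d₂, y) = β(d, y₁) y₂`. -/
lemma transpose_smul_eq (hφ : ∀ f c, φ (MulOpposite.op f • c) = φ c * f) (y d : C) :
    transpose φ y • d = MulOpposite.op (φ d) • y := by
  refine eq_of_forall_apply_eq (K := K) fun f => ?_
  rw [← mul_apply_eq_apply_smul, ← transpose_smul hφ, transpose_apply,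
    ← mul_apply_eq_apply_smul, mul_apply_eq_apply_op_smul]

/-- `C = C · φ(C)`. -/
lemma exists_op_smul_eq (hφ : ∀ f c, φ (MulOpposite.op f • c) = φ c * f)
    (hinj : Function.Injective φ) (d : C) : ∃ y : C, MulOpposite.op (φ d) • y = d := by
  obtain ⟨D, hD, h⟩ := exists_fg_smul_eq_self (K := K) d
  obtain ⟨y, hy⟩ := exists_transpose_eq_counit hinj hD
  exact ⟨y, by rw [← transpose_smul_eq hφ, h _ hy]⟩

/-- The image `φ(C)` has no right annihilator in `C*`, because
`C = C · φ(C)`. -/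
lemma eq_zero_of_forall_mul_eq_zero (hφ : ∀ f c, φ (MulOpposite.op f • c) = φ c * f)
    (hinj : Function.Injective φ) {x : DualAlg K C} (hx : ∀ c, φ c * x = 0) : x = 0 := by
  apply WithConv.ofConv_injective
  ext d
  obtain ⟨y, hy⟩ := exists_op_smul_eq hφ hinj d
  rw [← hy, ← mul_apply_eq_apply_op_smul, hx]
  rfl

/-- Let `I = φ(C)` be the rational part of the right module `C*`. If `e` is rational on the left,
then `I e` is finite dimensional, and contained in the right ideal `I`; hence it is annihilated by
the forms `f` that vanish on some finite dimensional subspace of `C`. As `I` has no right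
annihilator, `I e f = 0` implies `e f = 0`, and `e` is rational on the right. -/
lemma leftRat_subset_rightRat (hrange : ∀ x, x ∈ rightRat K C (DualAlg K C) ↔ ∃ c, φ c = x)
    (hφ : ∀ f c, φ (MulOpposite.op f • c) = φ c * f)
    (hinj : Function.Injective φ) {e : DualAlg K C} (he : e ∈ leftRat K C (DualAlg K C)) :
    e ∈ rightRat K C (DualAlg K C) := by
  obtain ⟨t, ht⟩ := mem_leftRat_iff.mp he
  obtain ⟨V, hV, hVt⟩ := exists_fg_evalRight_mem t
  have hFV : LinearMap.range (LinearMap.mulRight K e ∘ₗ φ) ≤ V := by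
    rintro _ ⟨c, rfl⟩
    change φ c * e ∈ V
    rw [ht]
    exact hVt _
  have : FiniteDimensional K V := Module.Finite.iff_fg.mpr hV
  have hF : (LinearMap.range (LinearMap.mulRight K e ∘ₗ φ)).FG :=
    Module.Finite.iff_fg.mp (Submodule.finiteDimensional_of_le hFV)
  obtain ⟨D, hD, h⟩ := exists_fg_mul_eq_zero hF (by
    rintro _ ⟨c, rfl⟩
    exact (hrange _).mpr ⟨MulOpposite.op e • c, hφ e c⟩)
  refine mem_rightRat_of_fg hD fun f hf => ?_
  refine eq_zero_of_forall_mul_eq_zero hφ hinj fun c => ?_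
  rw [← mul_assoc]
  exact h f hf _ ⟨c, rfl⟩

lemma rightRatForms_separatesPoints (hrange : ∀ x, x ∈ rightRat K C (DualAlg K C) ↔ ∃ c, φ c = x)
    (hφ : ∀ f c, φ (MulOpposite.op f • c) = φ c * f)
    (hinj : Function.Injective φ) : SeparatesPoints (rightRatForms K C : Set (C →ₗ[K] K)) := by
  intro c hc
  obtain ⟨f, hf, hfc⟩ := leftRatForms_separatesPoints hφ hinj c hc
  exact ⟨f, mem_rightRatForms.mpr
    (leftRat_subset_rightRat hrange hφ hinj (mem_leftRatForms.mp hf)), hfc⟩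

lemma transpose_injective (hrange : ∀ x, x ∈ rightRat K C (DualAlg K C) ↔ ∃ c, φ c = x)
    (hφ : ∀ f c, φ (MulOpposite.op f • c) = φ c * f)
    (hinj : Function.Injective φ) : Function.Injective (transpose φ) := by
  rw [injective_iff_map_eq_zero]
  intro d hd
  by_contra hne
  obtain ⟨f, hf, hfd⟩ := rightRatForms_separatesPoints hrange hφ hinj d hne
  obtain ⟨c, hc⟩ := (hrange _).mp (mem_rightRatForms.mp hf)
  apply hfd
  change (WithConv.toConv f).ofConv d = 0
  rw [← hc, ← transpose_apply, hd]
  rfl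

/-- An element `f` rational on the left is also rational on the right, so `f = f * ψ(y)` as soon as
`ψ(y)` agrees with the counit on a large enough finite dimensional subspace; here `ψ` is the
transpose of `φ`. -/
lemma exists_transpose_eq (hrange : ∀ x, x ∈ rightRat K C (DualAlg K C) ↔ ∃ c, φ c = x)
    (hφ : ∀ f c, φ (MulOpposite.op f • c) = φ c * f)
    (hinj : Function.Injective φ) {f : DualAlg K C} (hf : f ∈ leftRat K C (DualAlg K C)) :
    ∃ d, transpose φ d = f := by
  obtain ⟨t, ht⟩ := mem_rightRat_iff.mp (leftRat_subset_rightRat hrange hφ hinj hf)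
  obtain ⟨D, hD, h⟩ := exists_fg_evalLeft_eq t
  obtain ⟨y, hy⟩ := exists_transpose_eq_counit hinj hD
  refine ⟨f • y, ?_⟩
  rw [transpose_smul hφ, ht, h _ (1 : DualAlg K C).ofConv (by rw [ofConv_one]; exact hy), ← ht,
    mul_one]

end Form

/-! ### Right comodules as representations of the dual algebra -/

section Representations

variable {K : Type u} {C : Type v} [Field K] [AddCommGroup C] [Module K C] [Coalgebra K C]
variable {M : Type w} [AddCommGroup M] [Module K M] {N : Type w₁} [AddCommGroup N] [Module K N]

/-- The representation of `C*` on a right comodule: `f` acts as `m ↦ m₀ f(m₁)`. -/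
noncomputable def RightComodule.act (ρ : RightComodule K C M) :
    DualAlg K C →ₐ[K] Module.End K M :=
  AlgHom.ofLinearMap
    { toFun f := evalRight M f.ofConv ∘ₗ ρ.coact
      map_add' f g := by ext m; simp [evalRight_add]
      map_smul' a f := by ext m; simp [evalRight_smul] }
    (LinearMap.ext fun m => ρ.toModule.one_smul m)
    (fun f g => LinearMap.ext fun m => ρ.toModule.mul_smul f g m)

lemma RightComodule.act_apply (ρ : RightComodule K C M) (f : DualAlg K C) (m : M) :
    ρ.act f m = evalRight M f.ofConv (ρ.coact m) := rfl

lemma RightComodule.isHom_iff {ρ : RightComodule K C M} {σ : RightComodule K C N}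
    {φ : M →ₗ[K] N} : ρ.IsHom σ φ ↔ ∀ f m, φ (ρ.act f m) = σ.act f (φ m) := by
  constructor
  · intro h f m
    have hm := LinearMap.congr_fun h m
    simp only [LinearMap.comp_apply] at hm
    rw [act_apply, act_apply, hm, evalRight_natural]
  · intro h
    refine LinearMap.ext fun m => evalRight_ext fun f => ?_
    have hm := h (WithConv.toConv f) m
    rw [act_apply, act_apply] at hm
    rw [LinearMap.comp_apply, LinearMap.comp_apply, evalRight_natural]
    exact hm.symm

/-- A representation of `C*` on `M` is rational if the action on each vector depends only on the
restriction of the linear forms to a finite dimensional subspace of `C`. -/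
def IsRational (T : DualAlg K C →ₐ[K] Module.End K M) : Prop :=
  ∀ m, ∃ D : Submodule K C, D.FG ∧ ∀ f : DualAlg K C, (∀ d ∈ D, f.ofConv d = 0) → T f m = 0

lemma IsRational.exists_coact {T : DualAlg K C →ₐ[K] Module.End K M} (hT : IsRational T) :
    ∃ ρ : M →ₗ[K] M ⊗[K] C, ∀ f m, T f m = evalRight M f.ofConv (ρ m) := by
  have h : ∀ m, ∃ t : M ⊗[K] C, ∀ f : DualAlg K C, T f m = evalRight M f.ofConv t := by
    intro m
    obtain ⟨D, hD, h⟩ := hT m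
    obtain ⟨t, ht⟩ := exists_evalRight_eq
      (LinearMap.applyₗ m ∘ₗ T.toLinearMap ∘ₗ
        (WithConv.linearEquiv K (C →ₗ[K] K)).symm.toLinearMap) hD fun f hf => h (.toConv f) hf
    exact ⟨t, fun f => ht f.ofConv⟩
  choose ρ hρ using h
  refine ⟨⟨⟨ρ, fun m n => evalRight_ext fun f => ?_⟩, fun a m => evalRight_ext fun f => ?_⟩, ?_⟩
  · have h := hρ (m + n) (.toConv f)
    rw [map_add, hρ, hρ] at h
    rw [map_add]
    exact h.symm
  · have h := hρ (a • m) (.toConv f)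
    rw [map_smul, hρ] at h
    rw [map_smul]
    exact h.symm
  · exact fun f m => hρ m f

/-- The right comodule structure of a rational representation of `C*`. -/
noncomputable def IsRational.comodule {T : DualAlg K C →ₐ[K] Module.End K M} (hT : IsRational T) :
    RightComodule K C M where
  coact := hT.exists_coact.choose
  coassoc := by
    have h := hT.exists_coact.choose_spec
    set ρ := hT.exists_coact.choose
    refine LinearMap.ext fun m => ?_
    simp only [LinearMap.comp_apply, LinearEquiv.coe_coe]
    rw [← LinearEquiv.eq_symm_apply]
    refine evalRight_ext fun g => evalRight_ext fun f => ?_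
    have h2 := h (.toConv f * .toConv g) m
    rw [evalRight_mul, map_mul, Module.End.mul_apply, h, h] at h2
    rw [evalRight_natural]
    exact h2
  counit_coact := by
    have h := hT.exists_coact.choose_spec
    set ρ := hT.exists_coact.choose
    refine LinearMap.ext fun m => (TensorProduct.rid K M).injective ?_
    have h2 := h 1 m
    rw [ofConv_one, map_one] at h2
    simpa [evalRight] using h2.symm

lemma IsRational.comodule_act {T : DualAlg K C →ₐ[K] Module.End K M} (hT : IsRational T) :
    hT.comodule.act = T :=
  AlgHom.ext fun f => LinearMap.ext fun m => (hT.exists_coact.choose_spec f m).symm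

lemma RightComodule.isRational (ρ : RightComodule K C M) : IsRational ρ.act := fun m =>
  exists_fg_evalRight_eq_zero (ρ.coact m) |>.imp fun _ h => ⟨h.1, fun f hf => h.2 f.ofConv hf⟩

lemma RightComodule.IsSubcomodule.act_mem {ρ : RightComodule K C M} {N : Submodule K M}
    (hN : ρ.IsSubcomodule N) (f : DualAlg K C) {n : M} (hn : n ∈ N) : ρ.act f n ∈ N := by
  obtain ⟨t, ht⟩ := hN n hn
  rw [act_apply, ← ht, evalRight_natural]
  exact Subtype.property _

/-- An invariant subspace of a right comodule is a right comodule. -/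
lemma RightComodule.exists_restrict (ρ : RightComodule K C M) {N : Submodule K M}
    (hN : ∀ f, ∀ n ∈ N, ρ.act f n ∈ N) :
    ∃ σ : RightComodule K C N, ∀ f (n : N), (σ.act f n : M) = ρ.act f n := by
  let T : DualAlg K C →ₐ[K] Module.End K N := AlgHom.ofLinearMap
    { toFun f := (ρ.act f).restrict (hN f)
      map_add' f g := by ext n; simp
      map_smul' a f := by ext n; simp }
    (by ext n; simp) (fun f g => by ext n; simp)
  have hT : ∀ f (n : N), (T f n : M) = ρ.act f n := fun f n => rfl
  have hrat : IsRational T := fun n => by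
    obtain ⟨D, hD, h⟩ := ρ.isRational n
    exact ⟨D, hD, fun f hf => Subtype.ext (by rw [hT, h f hf]; rfl)⟩
  exact ⟨hrat.comodule, by rw [hrat.comodule_act]; exact hT⟩

end Representations

/-! ### Projective covers -/

section Idempotents

open Polynomial

/-- The idempotent polynomial of Fitting's lemma: if `x` is algebraic over a field, then some
polynomial in `x` without constant term is an idempotent `q` with `(1 - q) x ^ n = 0` for some
`n`. -/
lemma exists_isIdempotentElem_aeval {K : Type u} {R : Type v} [Field K] [Ring R] [Algebra K R]
    {x : R} (hx : IsAlgebraic K x) :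
    ∃ (s : K[X]) (n : ℕ), IsIdempotentElem (aeval x (s * X)) ∧
      aeval x ((1 - s * X) * X ^ n) = 0 := by
  obtain ⟨f, hf0, hf⟩ := hx
  obtain ⟨g, hfg, hg⟩ := f.exists_eq_pow_rootMultiplicity_mul_and_not_dvd hf0 0
  rw [map_zero, sub_zero] at hfg hg
  set n := f.rootMultiplicity 0
  obtain ⟨a, b, hab⟩ : IsCoprime (X ^ (n + 1)) g :=
    (Polynomial.irreducible_X.coprime_iff_not_dvd.mpr hg).pow_left
  have h1 : 1 - a * X ^ n * X = b * g := by rw [← hab]; ring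
  refine ⟨a * X ^ n, n, ?_, ?_⟩
  · rw [IsIdempotentElem, ← map_mul, ← sub_eq_zero, ← map_sub]
    have h2 : a * X ^ n * X * (a * X ^ n * X) - a * X ^ n * X = -(a * X * b) * f := by
      rw [hfg]
      linear_combination (-(a * X ^ n * X)) * h1
    rw [h2, map_mul, hf, mul_zero]
  · have h2 : (1 - a * X ^ n * X) * X ^ n = b * f := by
      rw [h1, hfg]; ring
    rw [h2, map_mul, hf, mul_zero]

end Idempotents

section Covers

open Polynomial

variable {K : Type u} {C : Type v} [Field K] [AddCommGroup C] [Module K C] [Coalgebra K C]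
variable {M : Type w} [AddCommGroup M] [Module K M]

lemma RightComodule.IsProjective.of_retract {P Q : Type w} [AddCommGroup P] [Module K P]
    [AddCommGroup Q] [Module K Q] {σ : RightComodule K C P} {τ : RightComodule K C Q}
    (hσ : σ.IsProjective) {i : Q →ₗ[K] P} {r : P →ₗ[K] Q} (hi : τ.IsHom σ i) (hr : σ.IsHom τ r)
    (hri : r ∘ₗ i = LinearMap.id) : τ.IsProjective := by
  intro A B _ _ _ _ α β p φ hp hps hφ
  rw [isHom_iff] at hi hr hφ
  obtain ⟨ψ, hψ, hpψ⟩ := hσ A B α β p (φ ∘ₗ r) hp hps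
    (isHom_iff.mpr fun f m => by simp [hr, hφ])
  rw [isHom_iff] at hψ
  refine ⟨ψ ∘ₗ i, isHom_iff.mpr fun f m => by simp [hi, hψ], ?_⟩
  rw [← LinearMap.comp_assoc, hpψ, LinearMap.comp_assoc, hri, LinearMap.comp_id]

/-- `ρ` is the image of a projective comodule of finite dimension `d`. -/
def RightComodule.IsImageOfProjective (ρ : RightComodule K C M) (d : ℕ) : Prop :=
  ∃ (P : Type w) (_ : AddCommGroup P) (_ : Module K P) (σ : RightComodule K C P) (π : P →ₗ[K] M),
    FiniteDimensional K P ∧ Module.finrank K P = d ∧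
      σ.IsProjective ∧ σ.IsHom ρ π ∧ Function.Surjective π

/-- A projective comodule of minimal finite dimension mapping onto `ρ` is a projective cover. If
`N + ker π = P`, lift `π` to `h : P → N`; a suitable polynomial in `h` is an idempotent whose image
is a direct summand of `P` that is contained in `N` and still maps onto `ρ`. -/
lemma RightComodule.IsImageOfProjective.hasProjectiveCover {ρ : RightComodule K C M}
    (h : ∃ d, ρ.IsImageOfProjective d) : ρ.HasProjectiveCover := by
  classical
  obtain ⟨P, _, _, σ, π, hfin, hdim, hproj, hπ, hsurj⟩ := Nat.find_spec h
  refine ⟨P, _, _, σ, π, hproj, hπ, hsurj, fun N hN hNπ => ?_⟩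
  have hπ' := isHom_iff.mp hπ
  obtain ⟨τ, hτ⟩ := σ.exists_restrict fun f n => hN.act_mem f (n := n)
  have hNsurj : Function.Surjective (π ∘ₗ N.subtype) := by
    intro m
    obtain ⟨x, rfl⟩ := hsurj m
    obtain ⟨n, hn, k, hk, rfl⟩ := Submodule.mem_sup.mp (hNπ ▸ Submodule.mem_top : x ∈ _)
    exact ⟨⟨n, hn⟩, by simp [LinearMap.mem_ker.mp hk]⟩
  obtain ⟨ψ, hψ, hπψ⟩ := hproj N M τ ρ (π ∘ₗ N.subtype) π
    (isHom_iff.mpr fun f n => by simp [hτ, hπ']) hNsurj hπ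
  let e : Module.End K P := N.subtype ∘ₗ ψ
  have hπe : π ∘ₗ e = π := hπψ
  have hcomm : ∀ f, Commute (σ.act f) e := fun f => LinearMap.ext fun x => by
    have := isHom_iff.mp hψ f x
    simp [e, this, hτ]
  obtain ⟨s, n, hq, hqn⟩ :=
    exists_isIdempotentElem_aeval (Algebra.IsIntegral.isIntegral (R := K) e).isAlgebraic
  set q := aeval e (s * X) with hqdef
  have hqe : q = e * aeval e s := by rw [hqdef, mul_comm, map_mul, aeval_X]
  have hqcomm : ∀ f, Commute (σ.act f) q := fun f =>
    Algebra.commute_of_mem_adjoin_singleton_of_commute (R := K)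
      (aeval_mem_adjoin_singleton K e) (hcomm f)
  have hπpow : ∀ k, π ∘ₗ (e ^ k) = π := fun k => by
    induction k with
    | zero => rfl
    | succ k ih => rw [pow_succ', Module.End.mul_eq_comp, ← LinearMap.comp_assoc, hπe, ih]
  have hπq : π ∘ₗ q = π := by
    have h1 : e ^ n * (1 - q) = 0 := by
      rw [← hqn, hqdef, mul_comm (1 - s * X)]
      simp
    have h2 : π ∘ₗ (e ^ n * (1 - q)) = π ∘ₗ (1 - q) := by
      rw [Module.End.mul_eq_comp, ← LinearMap.comp_assoc, hπpow]
    rw [h1, LinearMap.comp_zero, LinearMap.comp_sub] at h2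
    exact (sub_eq_zero.mp h2.symm).symm
  have hqq : ∀ x, q (q x) = q x := fun x => LinearMap.congr_fun hq x
  obtain ⟨υ, hυ⟩ := σ.exists_restrict (N := LinearMap.range q) (by
    rintro f _ ⟨x, rfl⟩
    exact ⟨σ.act f x, (LinearMap.congr_fun (hqcomm f) x).symm⟩)
  have hυπ : υ.IsHom ρ (π ∘ₗ (LinearMap.range q).subtype) :=
    isHom_iff.mpr fun f x => by simp [hυ, hπ']
  have hυproj : υ.IsProjective := hproj.of_retract (i := (LinearMap.range q).subtype)
    (r := q.rangeRestrict) (isHom_iff.mpr fun f x => hυ f x)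
    (isHom_iff.mpr fun f x => Subtype.ext <| by
      rw [hυ]
      exact (LinearMap.congr_fun (hqcomm f) x).symm)
    (by ext ⟨_, x, rfl⟩; exact hqq x)
  have hle : Module.finrank K P ≤ Module.finrank K (LinearMap.range q) := by
    rw [hdim]
    exact Nat.find_min' h ⟨_, _, _, υ, _, inferInstance, rfl, hυproj, hυπ,
      fun m => by
        obtain ⟨x, rfl⟩ := hsurj m
        exact ⟨⟨q x, x, rfl⟩, LinearMap.congr_fun hπq x⟩⟩
  have htop : LinearMap.range q = ⊤ :=
    Submodule.eq_top_of_finrank_eq (le_antisymm (Submodule.finrank_le _) hle)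
  rw [eq_top_iff, ← htop]
  rintro _ ⟨x, rfl⟩
  rw [hqe]
  exact Subtype.property _

end Covers

section Existence

open Polynomial

variable {K : Type u} {C : Type v} [Field K] [AddCommGroup C] [Module K C] [Coalgebra K C]
variable {M : Type w} [AddCommGroup M] [Module K M]

lemma exists_fg_mul_mem {e : DualAlg K C} (he : e ∈ leftRat K C (DualAlg K C)) :
    ∃ V : Submodule K (DualAlg K C), V.FG ∧ ∀ f, f * e ∈ V := by
  obtain ⟨t, ht⟩ := mem_leftRat_iff.mp he
  obtain ⟨V, hV, h⟩ := exists_fg_evalRight_mem t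
  exact ⟨V, hV, fun f => by rw [ht]; exact h _⟩

/-- The powers of a rational element lie in a finite dimensional space. -/
lemma isAlgebraic_of_mem_leftRat {e : DualAlg K C} (he : e ∈ leftRat K C (DualAlg K C)) :
    IsAlgebraic K e := by
  obtain ⟨V, hV, h⟩ := exists_fg_mul_mem he
  have : FiniteDimensional K V := Module.Finite.iff_fg.mpr hV
  have : IsNoetherian K V := isNoetherian_of_isNoetherianRing_of_finite K V
  let T : K[X] →ₗ[K] V := ((LinearMap.mulRight K e) ∘ₗ (aeval e).toLinearMap).codRestrict V
    fun f => h _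
  have hT : ¬ Function.Injective T := fun hinj =>
    Polynomial.not_finite (R := K) (Module.Finite.of_injective T hinj)
  rw [injective_iff_map_eq_zero] at hT
  push Not at hT
  obtain ⟨f, hf, hf0⟩ := hT
  refine ⟨f * X, mul_ne_zero hf0 X_ne_zero, ?_⟩
  rw [map_mul, aeval_X]
  exact congrArg Subtype.val hf

/-- If the rational part of the left module `C*` is dense, it contains an idempotent that acts on
a given finite dimensional right comodule as the identity. -/
lemma exists_isIdempotentElem_act_eq_one [FiniteDimensional K M]
    (hsep : SeparatesPoints (leftRatForms K C : Set (C →ₗ[K] K))) (ρ : RightComodule K C M) :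
    ∃ p ∈ leftRat K C (DualAlg K C), IsIdempotentElem p ∧ ρ.act p = 1 := by
  let b := Module.finBasis K M
  choose D hD h using fun i => exists_fg_evalRight_eq (ρ.coact (b i))
  obtain ⟨e, he, hed⟩ :=
    hsep.exists_eq_on (Submodule.fg_iSup _ hD) (Coalgebra.counit (R := K) (A := C))
  rw [mem_leftRatForms] at he
  have he1 : ρ.act (.toConv e) = 1 := by
    rw [← map_one ρ.act]
    refine b.ext fun i => ?_
    rw [RightComodule.act_apply, RightComodule.act_apply]
    exact h i _ _ fun d hd => by
      rw [ofConv_one]; exact hed d (Submodule.mem_iSup_of_mem i hd)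
  obtain ⟨s, n, hq, hqn⟩ := exists_isIdempotentElem_aeval (isAlgebraic_of_mem_leftRat he)
  refine ⟨_, ?_, hq, ?_⟩
  · rw [map_mul, aeval_X]
    exact (leftRat K C (DualAlg K C)).smul_mem _ he
  · have h0 := congrArg ρ.act hqn
    rw [map_mul (aeval _), map_sub (aeval _), map_mul ρ.act, map_sub ρ.act, map_pow (aeval _),
      aeval_X, map_pow ρ.act, he1, one_pow, mul_one, map_zero, map_one, map_one] at h0
    exact (sub_eq_zero.mp h0).symm

/-- For an idempotent `p`, the left ideal `C* p` represents `B ↦ p B`. Hence `C* p ⊗ M`, with `C*`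
acting on the first factor, is projective among the rational representations; it is rational and
finite dimensional if `p` is rational, and maps onto `M` if `p` acts on `M` as the identity. -/
lemma RightComodule.exists_isImageOfProjective [FiniteDimensional K M] [Small.{w} K]
    (hsep : SeparatesPoints (leftRatForms K C : Set (C →ₗ[K] K))) (ρ : RightComodule K C M) :
    ∃ d, ρ.IsImageOfProjective d := by
  obtain ⟨p, hp, hpp, hpM⟩ := exists_isIdempotentElem_act_eq_one hsep ρ
  let L : Submodule (DualAlg K C) (DualAlg K C) := Ideal.span {p}
  have hpL : p ∈ L := Ideal.mem_span_singleton_self p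
  have hL : L ≤ leftRat K C (DualAlg K C) := by
    rw [Ideal.span_le, Set.singleton_subset_iff]
    exact hp
  have hLp : ∀ x ∈ L, x * p = x := by
    intro x hx
    obtain ⟨a, rfl⟩ := Ideal.mem_span_singleton'.mp hx
    rw [mul_assoc, hpp]
  have hLfin : FiniteDimensional K L := by
    obtain ⟨V, hV, h⟩ := exists_fg_mul_mem hp
    have : FiniteDimensional K V := Module.Finite.iff_fg.mpr hV
    exact Submodule.finiteDimensional_of_le (S₁ := L.restrictScalars K) (S₂ := V)
      fun x hx => hLp x hx ▸ h x
  have hLfree : Module.Free K L := Module.Free.of_divisionRing K L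
  -- `C* p ⊗ M`, moved to the universe of `M`
  let n := Module.finrank K (L ⊗[K] M)
  let E : (L ⊗[K] M) ≃ₗ[K] Shrink.{w} (Fin n → K) :=
    (Module.finBasis K (L ⊗[K] M)).equivFun.trans (Shrink.linearEquiv K _).symm
  let T : DualAlg K C →ₐ[K] Module.End K (Shrink.{w} (Fin n → K)) :=
    (LinearEquiv.conjAlgEquiv K E).toAlgHom.comp
      ((Module.End.rTensorAlgHom K L M).comp (Algebra.lsmul K K L))
  have hT : ∀ f (x : L) (m : M), T f (E (x ⊗ₜ m)) = E ((f • x) ⊗ₜ m) := by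
    intro f x m
    change E ((Algebra.lsmul K K L f).rTensor M (E.symm (E (x ⊗ₜ m)))) = _
    rw [E.symm_apply_apply]
    rfl
  have hrat : IsRational T := by
    intro v
    obtain ⟨y, rfl⟩ := E.surjective v
    induction y with
    | zero => exact ⟨⊥, Submodule.fg_bot, fun f _ => by simp⟩
    | add x y hx hy =>
      obtain ⟨D, hD, hx⟩ := hx
      obtain ⟨D', hD', hy⟩ := hy
      refine ⟨D ⊔ D', hD.sup hD', fun f hf => ?_⟩
      rw [map_add, map_add, hx f fun d hd => hf d (Submodule.mem_sup_left hd),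
        hy f fun d hd => hf d (Submodule.mem_sup_right hd), add_zero]
    | tmul x m =>
      obtain ⟨t, ht⟩ := mem_leftRat_iff.mp (hL x.2)
      obtain ⟨D, hD, h⟩ := exists_fg_evalRight_eq_zero t
      refine ⟨D, hD, fun f hf => ?_⟩
      have hfx : f • x = 0 := Subtype.ext ((ht f).trans (h f.ofConv hf))
      rw [hT, hfx, TensorProduct.zero_tmul, map_zero]
  let σ := hrat.comodule
  have hσ : ∀ f (x : L) (m : M), σ.act f (E (x ⊗ₜ m)) = E ((f • x) ⊗ₜ m) := by
    rw [hrat.comodule_act]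
    exact hT
  -- a linear map `g : M → A` induces a morphism on `C* p ⊗ M`
  have key : ∀ {A : Type w} [AddCommGroup A] [Module K A] (α : RightComodule K C A)
      (g : M →ₗ[K] A), ∃ ψ : Shrink.{w} (Fin n → K) →ₗ[K] A, σ.IsHom α ψ ∧
        ∀ x m, ψ (E (x ⊗ₜ m)) = α.act x (g m) := by
    intro A _ _ α g
    let ψ₀ : L ⊗[K] M →ₗ[K] A := TensorProduct.lift
      ((LinearMap.lcomp K A g) ∘ₗ α.act.toLinearMap ∘ₗ (L.restrictScalars K).subtype)
    have hψ₀ : ∀ x m, ψ₀ (x ⊗ₜ m) = α.act x (g m) := fun x m => rfl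
    have hψ : ∀ x m, (ψ₀ ∘ₗ E.symm.toLinearMap) (E (x ⊗ₜ m)) = α.act x (g m) := by
      intro x m
      simp [hψ₀]
    refine ⟨ψ₀ ∘ₗ E.symm.toLinearMap, isHom_iff.mpr fun f v => ?_, hψ⟩
    obtain ⟨y, rfl⟩ := E.surjective v
    induction y with
    | zero => simp
    | add x y hx hy => simp only [map_add, hx, hy]
    | tmul x m =>
      rw [hσ, hψ, hψ, Submodule.coe_smul, smul_eq_mul, map_mul, Module.End.mul_apply]
  obtain ⟨π, hπ, hπE⟩ := key ρ LinearMap.id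
  refine ⟨n, Shrink.{w} (Fin n → K), inferInstance, inferInstance, σ, π,
    Module.Finite.equiv (Shrink.linearEquiv K (Fin n → K)).symm, ?_, ?_, hπ, fun m => ?_⟩
  · rw [(Shrink.linearEquiv K (Fin n → K)).finrank_eq, Module.finrank_fin_fun]
  · intro A B _ _ _ _ α β r φ hr hrs hφ
    obtain ⟨s, hs⟩ := r.exists_rightInverse_of_surjective (LinearMap.range_eq_top.mpr hrs)
    have hs' : ∀ b, r (s b) = b := fun b => LinearMap.congr_fun hs b
    obtain ⟨ψ, hψ, hψE⟩ := key α (s ∘ₗ φ ∘ₗ E.toLinearMap ∘ₗ TensorProduct.mk K L M ⟨p, hpL⟩)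
    refine ⟨ψ, hψ, LinearMap.ext fun v => ?_⟩
    rw [isHom_iff] at hr hφ
    obtain ⟨y, rfl⟩ := E.surjective v
    induction y with
    | zero => simp
    | add x y hx hy => simp only [map_add, hx, hy]
    | tmul x m =>
      have hxp : (x : DualAlg K C) • (⟨p, hpL⟩ : L) = x := Subtype.ext (hLp x x.2)
      rw [LinearMap.comp_apply, hψE, hr]
      simp only [LinearMap.comp_apply, hs', LinearEquiv.coe_coe, TensorProduct.mk_apply]
      rw [← hφ, hσ, hxp]
  · refine ⟨E (⟨p, hpL⟩ ⊗ₜ m), ?_⟩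
    rw [hπE, hpM]
    rfl

lemma RightComodule.hasProjectiveCover_of_subsingleton [Subsingleton M] (ρ : RightComodule K C M) :
    ρ.HasProjectiveCover :=
  ⟨M, _, _, ρ, LinearMap.id, fun _ _ _ _ _ _ _ _ _ _ _ _ _ =>
    ⟨0, LinearMap.ext fun _ => by simp [Subsingleton.elim (_ : M) 0],
      LinearMap.ext fun _ => by simp [Subsingleton.elim (_ : M) 0]⟩,
    by simp [IsHom], Function.surjective_id, fun _ _ _ => Subsingleton.elim _ _⟩

/-- If the rational part of the left module `C*` is dense, then `C` is right semiperfect. -/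
theorem isRightSemiperfect_of_separatesPoints
    (hsep : SeparatesPoints (leftRatForms K C : Set (C →ₗ[K] K))) :
    IsRightSemiperfect.{u, v, w} K C := by
  intro M _ _ _ ρ
  rcases subsingleton_or_nontrivial M with _ | _
  · exact ρ.hasProjectiveCover_of_subsingleton
  · -- a nonzero space in `Type w` forces `K` to be `w`-small
    obtain ⟨m, hm⟩ := exists_ne (0 : M)
    have : Small.{w} K := small_of_injective (smul_left_injective K hm)
    exact RightComodule.IsImageOfProjective.hasProjectiveCover
      (ρ.exists_isImageOfProjective hsep)

end Existence

/-! ### The co-opposite coalgebra -/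

section CoOpposite

/-- The co-opposite coalgebra: the space `C` with the comultiplication `c ↦ c₂ ⊗ c₁`. Left
`C`-comodules are right comodules over it, and its dual algebra is opposite to `C*`. -/
def Cop (C : Type v) : Type v := C

variable {K : Type u} {C : Type v} [Field K] [AddCommGroup C] [Module K C]
variable {M : Type w} [AddCommGroup M] [Module K M] {N : Type w₁} [AddCommGroup N] [Module K N]

instance : AddCommGroup (Cop C) := inferInstanceAs (AddCommGroup C)
instance : Module K (Cop C) := inferInstanceAs (Module K C)

/-- Reversing the order of the factors exchanges the coassociativity laws of left and of right
coactions. -/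
lemma coassoc_comm_iff (Δ : C →ₗ[K] C ⊗[K] C) (ρ : M →ₗ[K] M ⊗[K] C) :
    (TensorProduct.assoc K M C C).toLinearMap ∘ₗ ρ.rTensor C ∘ₗ ρ =
        ((TensorProduct.comm K C C).toLinearMap ∘ₗ Δ).lTensor M ∘ₗ ρ ↔
      (TensorProduct.assoc K C C M).toLinearMap ∘ₗ
          Δ.rTensor M ∘ₗ (TensorProduct.comm K M C).toLinearMap ∘ₗ ρ =
        ((TensorProduct.comm K M C).toLinearMap ∘ₗ ρ).lTensor C ∘ₗ
          (TensorProduct.comm K M C).toLinearMap ∘ₗ ρ := by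
  let τ : M ⊗[K] (C ⊗[K] C) ≃ₗ[K] C ⊗[K] (C ⊗[K] M) :=
    (TensorProduct.congr (.refl K M) (TensorProduct.comm K C C)).trans
      ((TensorProduct.comm K M (C ⊗[K] C)).trans (TensorProduct.assoc K C C M))
  have h1 : ∀ x : M ⊗[K] C,
      τ (((TensorProduct.comm K C C).toLinearMap ∘ₗ Δ).lTensor M x) =
        TensorProduct.assoc K C C M (Δ.rTensor M (TensorProduct.comm K M C x)) := by
    intro x
    induction x with
    | zero => simp
    | add x y hx hy => simp only [map_add, hx, hy]
    | tmul m c => simp [τ]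
  have h2 : ∀ x : M ⊗[K] C, τ (TensorProduct.assoc K M C C (ρ.rTensor C x)) =
      ((TensorProduct.comm K M C).toLinearMap ∘ₗ ρ).lTensor C (TensorProduct.comm K M C x) := by
    intro x
    induction x with
    | zero => simp
    | add x y hx hy => simp only [map_add, hx, hy]
    | tmul m c =>
      simp only [LinearMap.rTensor_tmul, TensorProduct.comm_tmul, LinearMap.lTensor_tmul,
        LinearMap.comp_apply, LinearEquiv.coe_coe]
      generalize ρ m = y
      induction y with
      | zero => simp
      | add x y hx hy => simp only [TensorProduct.add_tmul, TensorProduct.tmul_add, map_add, hx, hy]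
      | tmul m d => simp [τ]
  simp only [LinearMap.ext_iff, LinearMap.comp_apply, LinearEquiv.coe_coe, ← h1, ← h2,
    τ.injective.eq_iff]
  exact ⟨fun h m => (h m).symm, fun h m => (h m).symm⟩

lemma lTensor_counit_comm_iff (ε : C →ₗ[K] K) (ρ : M →ₗ[K] M ⊗[K] C) :
    ε.lTensor M ∘ₗ ρ = (TensorProduct.mk K M K).flip 1 ↔
      ε.rTensor M ∘ₗ (TensorProduct.comm K M C).toLinearMap ∘ₗ ρ = TensorProduct.mk K K M 1 := by
  have h : ∀ x : M ⊗[K] C, ε.rTensor M (TensorProduct.comm K M C x) =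
      TensorProduct.comm K M K (ε.lTensor M x) := by
    intro x
    induction x with
    | zero => simp
    | add x y hx hy => simp only [map_add, hx, hy]
    | tmul m c => simp
  simp only [LinearMap.ext_iff, LinearMap.comp_apply, LinearEquiv.coe_coe, h,
    ← (TensorProduct.comm K M K).injective.eq_iff, LinearMap.flip_apply, TensorProduct.mk_apply,
    TensorProduct.comm_tmul]

lemma comm_comp_comm (f : M →ₗ[K] C ⊗[K] M) :
    (TensorProduct.comm K M C).toLinearMap ∘ₗ (TensorProduct.comm K C M).toLinearMap ∘ₗ f = f := by
  ext m
  simp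

lemma comm_lTensor (φ : M →ₗ[K] N) (x : C ⊗[K] M) :
    TensorProduct.comm K C N (φ.lTensor C x) = φ.rTensor C (TensorProduct.comm K C M x) := by
  induction x with
  | zero => simp
  | add x y hx hy => simp only [map_add, hx, hy]
  | tmul c m => simp

variable [Coalgebra K C]

instance : Coalgebra K (Cop C) where
  comul := (TensorProduct.comm K C C).toLinearMap ∘ₗ Coalgebra.comul (R := K) (A := C)
  counit := Coalgebra.counit (R := K) (A := C)
  coassoc := by
    refine (coassoc_comm_iff (C := C) (M := C) (Coalgebra.comul (R := K) (A := C))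
      ((TensorProduct.comm K C C).toLinearMap ∘ₗ Coalgebra.comul (R := K) (A := C))).mpr ?_
    rw [comm_comp_comm]
    exact Coalgebra.coassoc
  rTensor_counit_comp_comul := by
    refine (lTensor_counit_comm_iff (C := C) (M := C) (Coalgebra.counit (R := K) (A := C))
      (Coalgebra.comul (R := K) (A := C))).mp ?_
    exact Coalgebra.lTensor_counit_comp_comul
  lTensor_counit_comp_comul := by
    refine (lTensor_counit_comm_iff (C := C) (M := C) (Coalgebra.counit (R := K) (A := C))
      ((TensorProduct.comm K C C).toLinearMap ∘ₗ Coalgebra.comul (R := K) (A := C))).mpr ?_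
    rw [comm_comp_comm]
    exact Coalgebra.rTensor_counit_comp_comul

/-- A left `C`-comodule as a right comodule over the co-opposite coalgebra. -/
def LeftComodule.toCop (ρ : LeftComodule K C M) : RightComodule K (Cop C) M where
  coact := (TensorProduct.comm K C M).toLinearMap ∘ₗ ρ.coact
  coassoc := by
    refine (coassoc_comm_iff (C := C) (Coalgebra.comul (R := K) (A := C))
      ((TensorProduct.comm K C M).toLinearMap ∘ₗ ρ.coact)).mpr ?_
    rw [comm_comp_comm]
    exact ρ.coassoc
  counit_coact := by
    refine (lTensor_counit_comm_iff (C := C) (Coalgebra.counit (R := K) (A := C))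
      ((TensorProduct.comm K C M).toLinearMap ∘ₗ ρ.coact)).mpr ?_
    rw [comm_comp_comm]
    exact ρ.counit_coact

/-- A right comodule over the co-opposite coalgebra as a left `C`-comodule. -/
def RightComodule.ofCop (ρ : RightComodule K (Cop C) M) : LeftComodule K C M where
  coact := (TensorProduct.comm K M C).toLinearMap ∘ₗ ρ.coact
  coassoc := (coassoc_comm_iff (C := C) (Coalgebra.comul (R := K) (A := C)) ρ.coact).mp ρ.coassoc
  counit_coact :=
    (lTensor_counit_comm_iff (C := C) (Coalgebra.counit (R := K) (A := C)) ρ.coact).mp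
      ρ.counit_coact

lemma RightComodule.toCop_ofCop (ρ : RightComodule K (Cop C) M) : ρ.ofCop.toCop = ρ := by
  have h : ρ.ofCop.toCop.coact = ρ.coact :=
    LinearMap.ext fun m => (TensorProduct.comm K M C).symm_apply_apply (ρ.coact m)
  generalize ρ.ofCop.toCop = σ at h
  cases ρ
  cases σ
  congr

lemma LeftComodule.toCop_isHom_iff {ρ : LeftComodule K C M} {σ : LeftComodule K C N}
    {φ : M →ₗ[K] N} : ρ.toCop.IsHom σ.toCop φ ↔ ρ.IsHom σ φ := by
  have h : ∀ m, φ.rTensor (Cop C) (ρ.toCop.coact m) =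
      TensorProduct.comm K C N (φ.lTensor C (ρ.coact m)) := fun m => (comm_lTensor φ _).symm
  simp only [RightComodule.IsHom, LeftComodule.IsHom, LinearMap.ext_iff, LinearMap.comp_apply, h]
  exact forall_congr' fun m => (TensorProduct.comm K C N).injective.eq_iff

lemma RightComodule.isHom_ofCop_iff {ρ : LeftComodule K C N} {σ : RightComodule K (Cop C) M}
    {φ : M →ₗ[K] N} : σ.ofCop.IsHom ρ φ ↔ σ.IsHom ρ.toCop φ := by
  rw [← LeftComodule.toCop_isHom_iff, toCop_ofCop]

lemma LeftComodule.hasProjectiveCover_of_toCop {ρ : LeftComodule K C M}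
    (h : ρ.toCop.HasProjectiveCover) : ρ.HasProjectiveCover := by
  obtain ⟨P, _, _, σ, π, hσ, hπ, hsurj, hsmall⟩ := h
  refine ⟨P, _, _, σ.ofCop, π, ?_, RightComodule.isHom_ofCop_iff.mpr hπ, hsurj,
    fun N hN => hsmall N fun m hm => ?_⟩
  · intro A B _ _ _ _ α β p φ hp hps hφ
    obtain ⟨ψ, hψ, hpψ⟩ := hσ A B α.toCop β.toCop p φ (toCop_isHom_iff.mpr hp) hps
      (RightComodule.isHom_ofCop_iff.mp hφ)
    exact ⟨ψ, RightComodule.isHom_ofCop_iff.mpr hψ, hpψ⟩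
  · obtain ⟨t, ht⟩ := hN m hm
    refine ⟨TensorProduct.comm K C N t, (comm_lTensor (C := C) N.subtype t).symm.trans ?_⟩
    rw [ht]
    exact (TensorProduct.comm K C P).apply_symm_apply (σ.coact m)

/-- The convolution product over the co-opposite coalgebra is the opposite one. -/
lemma cop_mul (f g : C →ₗ[K] K) :
    (WithConv.toConv (A := Cop C →ₗ[K] K) f * WithConv.toConv (A := Cop C →ₗ[K] K) g).ofConv =
      (WithConv.toConv g * WithConv.toConv f : DualAlg K C).ofConv := by
  have h : ∀ x : C ⊗[K] C, LinearMap.mul' K K (TensorProduct.map f g (TensorProduct.comm K C C x)) =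
      LinearMap.mul' K K (TensorProduct.map g f x) := by
    intro x
    induction x with
    | zero => simp
    | add x y hx hy => simp only [map_add, hx, hy]
    | tmul a b => simp [mul_comm]
  exact LinearMap.ext fun c => h (Coalgebra.comul (R := K) (A := C) c)

/-- A form that is rational on the right over `C` is rational on the left over the co-opposite
coalgebra. -/
lemma rightRatForms_le_cop : rightRatForms K C ≤ leftRatForms K (Cop C) := by
  intro f hf
  obtain ⟨t, ht⟩ := mem_rightRat_iff.mp (mem_rightRatForms.mp hf)
  refine mem_leftRatForms.mpr (mem_leftRat_iff.mpr ⟨TensorProduct.comm K C (DualAlg K C) t,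
    fun g => WithConv.ofConv_injective ?_⟩)
  have h : ∀ g : C →ₗ[K] K, (WithConv.toConv (A := Cop C →ₗ[K] K) g *
      WithConv.toConv (A := Cop C →ₗ[K] K) f).ofConv =
        (evalRight (DualAlg K C) g (TensorProduct.comm K C (DualAlg K C) t)).ofConv := fun g => by
    rw [cop_mul, ht, evalRight_comm]
  exact h g.ofConv

/-- If the rational part of the right module `C*` is dense, then `C` is left semiperfect. -/
theorem isLeftSemiperfect_of_separatesPoints
    (hsep : SeparatesPoints (rightRatForms K C : Set (C →ₗ[K] K))) :
    IsLeftSemiperfect.{u, v, w} K C := by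
  intro M _ _ _ ρ
  refine LeftComodule.hasProjectiveCover_of_toCop
    (isRightSemiperfect_of_separatesPoints (fun c hc => ?_) M ρ.toCop)
  obtain ⟨f, hf, hfc⟩ := hsep c hc
  exact ⟨f, rightRatForms_le_cop hf, hfc⟩

end CoOpposite

/-! ### Isomorphisms of modules and of comodules -/

section Isomorphisms

variable {K : Type u} {C : Type v} [Field K] [AddCommGroup C] [Module K C] [Coalgebra K C]

/-- The left comodule structure on `V` that makes a linear isomorphism `C ≅ V` one of left
comodules. -/
def LeftComodule.transport {V : Type w} [AddCommGroup V] [Module K V] (E : C ≃ₗ[K] V) :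
    LeftComodule K C V where
  coact := E.toLinearMap.lTensor C ∘ₗ Coalgebra.comul ∘ₗ E.symm.toLinearMap
  coassoc := by
    refine LinearMap.ext fun m => evalLeft_ext fun f => evalLeft_ext fun g => ?_
    obtain ⟨c, rfl⟩ := E.surjective m
    simp only [LinearMap.comp_apply, LinearEquiv.coe_coe, E.symm_apply_apply, evalLeft_natural]
    have h := evalLeft_mul (.toConv f) (.toConv g)
      (E.toLinearMap.lTensor C (Coalgebra.comul (R := K) c))
    rw [evalLeft_natural, ← dual_op_smul_def, MulOpposite.op_mul, mul_smul] at h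
    exact h.symm
  counit_coact := by
    refine LinearMap.ext fun m => (TensorProduct.lid K V).injective ?_
    obtain ⟨c, rfl⟩ := E.surjective m
    have h : evalLeft V (Coalgebra.counit (R := K) (A := C))
        (E.toLinearMap.lTensor C (Coalgebra.comul (R := K) c)) = E c := by
      rw [evalLeft_natural, ← ofConv_one, ← dual_op_smul_def, MulOpposite.op_one, one_smul]
      rfl
    simpa [evalLeft] using h

lemma LeftComodule.transport_coact {V : Type w} [AddCommGroup V] [Module K V] (E : C ≃ₗ[K] V)
    (c : C) : (transport E).coact (E c) = E.toLinearMap.lTensor C (Coalgebra.comul c) := by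
  simp [transport]

lemma LeftComodule.transport_isHom {V : Type w} [AddCommGroup V] [Module K V] (E : C ≃ₗ[K] V) :
    (regular K C).IsHom (transport E) E.toLinearMap :=
  LinearMap.ext (transport_coact E)

lemma LeftComodule.evalLeft_transport_coact {V : Type w} [AddCommGroup V] [Module K V]
    (E : C ≃ₗ[K] V) (f : DualAlg K C) (c : C) :
    evalLeft V f.ofConv ((transport E).coact (E c)) = E (MulOpposite.op f • c) := by
  rw [transport_coact, evalLeft_natural, ← dual_op_smul_def]
  rfl

section

variable {V : Type w} [AddCommGroup V] [Module K V] [Module (DualAlg K C)ᵐᵒᵖ V]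
  [IsScalarTower K (DualAlg K C)ᵐᵒᵖ V]

/-- The scalar `a` acts as the form `a ε`, so morphisms of right `C*`-modules are `K`-linear. -/
lemma map_smul_of_op (e : C ≃ₗ[(DualAlg K C)ᵐᵒᵖ] V) (a : K) (c : C) : e (a • c) = a • e c := by
  have h : a • c = (a • (1 : (DualAlg K C)ᵐᵒᵖ)) • c := by
    rw [← MulOpposite.op_one, ← MulOpposite.op_smul, dual_op_smul_def]
    nth_rw 1 [← one_smul (DualAlg K C)ᵐᵒᵖ c]
    rw [← MulOpposite.op_one, dual_op_smul_def]
    simp [evalLeft, LinearMap.rTensor_smul]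
  rw [h, map_smul, smul_one_smul]

/-- The linear isomorphism underlying an isomorphism of right `C*`-modules. -/
def opLinearEquiv (e : C ≃ₗ[(DualAlg K C)ᵐᵒᵖ] V) : C ≃ₗ[K] V :=
  { e with map_smul' := map_smul_of_op e }

/-- A right `C*`-module isomorphic to `C` carries the left comodule structure transported from `C`;
conversely, an isomorphism of left comodules is one of the underlying right modules. -/
lemma nonempty_linearEquiv_iff_exists_comodule :
    Nonempty (C ≃ₗ[(DualAlg K C)ᵐᵒᵖ] V) ↔ ∃ ρ : LeftComodule K C V,
      (∀ (f : DualAlg K C) (m : V), MulOpposite.op f • m = evalLeft _ f.ofConv (ρ.coact m)) ∧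
      ∃ e : C ≃ₗ[K] V, (LeftComodule.regular K C).IsHom ρ e.toLinearMap := by
  constructor
  · rintro ⟨e⟩
    refine ⟨.transport (opLinearEquiv e), fun f m => ?_, _, LeftComodule.transport_isHom _⟩
    obtain ⟨c, rfl⟩ := (opLinearEquiv e).surjective m
    rw [LeftComodule.evalLeft_transport_coact]
    exact (e.map_smul (MulOpposite.op f) c).symm
  · rintro ⟨ρ, hρ, E, hE⟩
    refine ⟨{ E with map_smul' := fun f c => ?_ }⟩
    have h := LinearMap.congr_fun hE c
    simp only [LinearMap.comp_apply, LinearEquiv.coe_coe] at h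
    change E (f • c) = f • E c
    rw [← MulOpposite.op_unop f, hρ, h, evalLeft_natural, dual_op_smul_def]
    rfl

end

/-- If `C` is isomorphic to the rational part of the right module `C*`, then both rational parts are
dense, which gives semiperfectness, and the transpose of the isomorphism is one of `C` onto the
rational part of the left module `C*`. -/
theorem isSemiperfect_and_isoLeftRat_of_isoRightRat (h : IsoRightRat K C) :
    IsLeftSemiperfect.{u, v, w} K C ∧ IsRightSemiperfect.{u, v, w} K C ∧ IsoLeftRat K C := by
  obtain ⟨e⟩ := h
  let φ : C →ₗ[K] DualAlg K C :=
    { toFun c := e c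
      map_add' c d := congrArg Subtype.val (e.map_add c d)
      map_smul' a c :=
        congrArg Subtype.val (map_smul_of_op (V := rightRat K C (DualAlg K C)) e a c) }
  have hφ : ∀ f c, φ (MulOpposite.op f • c) = φ c * f := fun f c =>
    congrArg Subtype.val (e.map_smul (MulOpposite.op f) c)
  have hinj : Function.Injective φ := Subtype.val_injective.comp e.injective
  have hrange : ∀ x, x ∈ rightRat K C (DualAlg K C) ↔ ∃ c, φ c = x := fun x =>
    ⟨fun hx => (e.surjective ⟨x, hx⟩).imp fun c hc => congrArg Subtype.val hc,
      by rintro ⟨c, rfl⟩; exact (e c).2⟩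
  refine ⟨isLeftSemiperfect_of_separatesPoints (rightRatForms_separatesPoints hrange hφ hinj),
    isRightSemiperfect_of_separatesPoints (leftRatForms_separatesPoints hφ hinj), ?_⟩
  let ψ : C →ₗ[DualAlg K C] leftRat K C (DualAlg K C) :=
    { toFun d := ⟨transpose φ d, transpose_mem_leftRat hφ d⟩
      map_add' c d := Subtype.ext (map_add _ c d)
      map_smul' f d := Subtype.ext (transpose_smul hφ f d) }
  exact ⟨LinearEquiv.ofBijective ψ
    ⟨fun c d h => transpose_injective hrange hφ hinj (congrArg Subtype.val h),
      fun x => (exists_transpose_eq hrange hφ hinj x.2).imp fun d hd => Subtype.ext hd⟩⟩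

end Isomorphisms

end CoFrob

theorem theorem2p7 (K : Type u) (C : Type v) [Field K] [AddCommGroup C] [Module K C]
    [Coalgebra K C] :
    (CoFrob.IsoRightRat K C ↔ CoFrob.IsoRightRatComodule K C) ∧
    (CoFrob.IsoRightRat K C →
      CoFrob.IsLeftSemiperfect.{u, v, w} K C ∧ CoFrob.IsRightSemiperfect.{u, v, w} K C ∧
        CoFrob.IsoLeftRat K C) :=
  ⟨CoFrob.nonempty_linearEquiv_iff_exists_comodule (K := K) (C := C)
    (V := CoFrob.rightRat K C (CoFrob.DualAlg K C)),
    CoFrob.isSemiperfect_and_isoLeftRat_of_isoRightRat⟩
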